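/- Let $\mathcal M$ be a Markov decision process (MDP) with a countable state set $S$, partitioned into controlled and random states, with a transition relation $\to$ in which every state has at least one (possibly infinitely many) successor, with a probability distribution $P(s)$ over the successors of every random state $s$, and with real transition rewards $r(s\to s')$. Let $s_0\in S$ be an initial state. A strategy maps every finite history that ends in a controlled state to a probability distribution over the successors of that state; it is deterministic if all these distributions are Dirac, and memoryless if they depend only on the current state (MD: both). A strategy $\sigma$ is $\varepsilon$-optimal from $x$ for an event $\varphi$ if $\mathcal P_{x,\sigma}(\varphi)\ge\sup_{\sigma'}\mathcal P_{x,\sigma'}(\varphi)-\varepsilon$, where the supremum is over all strategies $\sigma'$. Let $$\mathit{TP}_{\liminf\ge 0}=\Big\{s_0s_1s_2\cdots \;\Big|\; \liminf_{n}\sum_{j=0}^{n-1} r(s_j\to s_{j+1})\ge 0\Big\}.$$ The MDP $S(R(\mathcal M))$ encodes a reward counter and a step counter into the states: its states are the triples $(s,q,n)$ with $s\in S$, $n\in\mathbb N$ and $q\in\mathbb R$ the total reward of some finite path of $\mathcal M$ from $s_0$ to $s$; it has a transition $(s,q,n)\to(s',q',n')$ if and only if $s\to s'$ in $\mathcal M$,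 $q'=q+r(s\to s')$ and $n'=n+1$; the state $(s,q,n)$ is controlled if and only if $s$ is, and otherwise this transition has probability $P(s)(s')$; its reward is $q'$. On a run $(s_0',q_0,n_0)(s_1',q_1,n_1)\cdots$ of $S(R(\mathcal M))$ the objective $\mathit{TP}_{\liminf\ge 0}$ means that the total reward of $\mathcal M$, counted from the encoded level $q_0$, satisfies $\liminf_n\big(q_0+\sum_{j<n} r(s_j'\to s_{j+1}')\big)\ge 0$; on runs it coincides with the point payoff objective of $S(R(\mathcal M))$, that the $\liminf$ of the transition rewards of $S(R(\mathcal M))$ is $\ge 0$. For the initial state $(s_0,0,0)$ one has $q_0=0$. Then for every $\varepsilon>0$: 1. for every state $x$ of $S(R(\mathcal M))$, in particular for $(s_0,0,0)$, there is an MD strategy in $S(R(\mathcal M))$ that is $\varepsilon$-optimal from $x$ for $\mathit{TP}_{\liminf\ge 0}$, and also for the point payoff objective of $S(R(\mathcal M))$; 2. there is a deterministic strategy in $\mathcal M$ that is $\varepsilon$-optimal from $s_0$ for $\mathit{TP}_{\liminf\ge 0}$ and uses only a step counter and a reward counter, i.e. its choice after a history depends only on the current controlled state, the number of steps taken so far and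 the sum of the transition rewards seen so far. -/

import Mathlib

open MeasureTheory ProbabilityTheory Filter

/-- A Markov decision process with set of states `S`: the states are partitioned into controlled
and random ones, every state has a successor, every random state carries a probability distribution
over its successors, and the transitions carry real rewards. -/
structure MDP (S : Type*) where
  controlled : Set S
  trans : S → S → Prop
  exists_succ : ∀ s, ∃ s', trans s s'
  prob : {s : S // s ∉ controlled} → PMF S
  prob_support : ∀ s, ∀ s' ∈ (prob s).support, trans s s'
  reward : S → S → ℝ

namespace MDP

/-- A history of length `n`: the states `h 0, …, h n` visited so far. -/
abbrev History (S : Type*) (n : ℕ) : Type _ := Finset.Iic n → S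

/-- The current (last) state of a history. -/
def History.last {S : Type*} {n : ℕ} (h : History S n) : S :=
  h ⟨n, Finset.mem_Iic.2 le_rfl⟩

/-- The sum of all transition rewards along a history. -/
noncomputable def History.totalReward {S : Type*} (M : MDP S) {n : ℕ} (h : History S n) : ℝ :=
  ∑ i : Fin n, M.reward (h ⟨i, Finset.mem_Iic.2 i.isLt.le⟩)
    (h ⟨i + 1, Finset.mem_Iic.2 i.isLt⟩)

/-- A general (history dependent, randomized) strategy: to every history that ends in a controlled
state it assigns a distribution over the successors of that state. (Its values at sequences that
are no partial runs are immaterial.) -/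
structure Strategy {S : Type*} (M : MDP S) where
  choice : ∀ {n : ℕ} (h : History S n), h.last ∈ M.controlled → PMF S
  choice_support : ∀ {n : ℕ} (h : History S n) (hc : h.last ∈ M.controlled),
    ∀ s' ∈ (choice h hc).support, M.trans h.last s'

section Measure

variable {S : Type*} {M : MDP S}

open Classical in
/-- The distribution of the next state after the history `h`: chosen by the strategy in a
controlled state, and by the MDP in a random state. -/
noncomputable def Strategy.next (σ : M.Strategy) {n : ℕ} (h : History S n) : PMF S :=
  if hc : h.last ∈ M.controlled then σ.choice h hc else M.prob ⟨h.last, hc⟩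

/-- The one-step transition kernel of a strategy at time `n`. -/
noncomputable def Strategy.kernel [Countable S] (σ : M.Strategy) (n : ℕ) :
    letI : MeasurableSpace S := ⊤
    Kernel (Finset.Iic n → S) S :=
  letI : MeasurableSpace S := ⊤
  Kernel.ofFunOfCountable fun h => (σ.next h).toMeasure

instance [Countable S] (σ : M.Strategy) (n : ℕ) :
    letI : MeasurableSpace S := ⊤
    IsMarkovKernel (σ.kernel n) :=
  letI : MeasurableSpace S := ⊤
  ⟨fun h => PMF.toMeasure.isProbabilityMeasure (σ.next h)⟩

/-- The probability that the play from `s₀` under `σ` belongs to the event `E`. The probability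
measure lives on all sequences of states (with the σ-algebra generated by the cylinders), and gives
full mass to the runs from `s₀`. -/
noncomputable def Strategy.probability [Countable S] (σ : M.Strategy) (s₀ : S)
    (E : Set (ℕ → S)) : ENNReal :=
  letI : MeasurableSpace S := ⊤
  Kernel.traj (X := fun _ => S) σ.kernel 0 (fun _ => s₀) E

/-- The value of the state `s₀` for the objective `E`. -/
noncomputable def value [Countable S] (M : MDP S) (s₀ : S) (E : Set (ℕ → S)) : ENNReal :=
  ⨆ σ : M.Strategy, σ.probability s₀ E

/-- `σ` is `ε`-optimal from `s₀` for the objective `E`. -/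
def Strategy.IsEpsOptimal [Countable S] (σ : M.Strategy) (ε : ℝ) (s₀ : S)
    (E : Set (ℕ → S)) : Prop :=
  M.value s₀ E - ENNReal.ofReal ε ≤ σ.probability s₀ E

/-- All choices are Dirac distributions. -/
def Strategy.IsDeterministic (σ : M.Strategy) : Prop :=
  ∀ (n : ℕ) (h : History S n) (hc : h.last ∈ M.controlled), ∃ s', σ.choice h hc = PMF.pure s'

/-- The choices depend on the current state only. -/
def Strategy.IsMemoryless (σ : M.Strategy) : Prop :=
  ∃ g : {s : S // s ∈ M.controlled} → PMF S,
    ∀ (n : ℕ) (h : History S n) (hc : h.last ∈ M.controlled), σ.choice h hc = g ⟨h.last, hc⟩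

/-- Memoryless deterministic strategies. -/
def Strategy.IsMD (σ : M.Strategy) : Prop :=
  σ.IsMemoryless ∧ σ.IsDeterministic

/-- The choices depend only on the current state, the number of steps taken so far and the sum of
the transition rewards seen so far. -/
def Strategy.UsesStepAndRewardCounter (σ : M.Strategy) : Prop :=
  ∃ g : {s : S // s ∈ M.controlled} → ℕ → ℝ → PMF S,
    ∀ (n : ℕ) (h : History S n) (hc : h.last ∈ M.controlled),
      σ.choice h hc = g ⟨h.last, hc⟩ n (h.totalReward M)

/-- The objective that the `liminf` of the point payoffs is nonnegative. -/
def pointPayoff (M : MDP S) : Set (ℕ → S) :=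
  {ρ | 0 ≤ liminf (fun n => ((M.reward (ρ n) (ρ (n + 1)) : ℝ) : EReal)) atTop}

/-- The objective that the `liminf` of the total payoffs is nonnegative. -/
def totalPayoff (M : MDP S) : Set (ℕ → S) :=
  {ρ | 0 ≤ liminf
    (fun n => ((∑ j ∈ Finset.range n, M.reward (ρ j) (ρ (j + 1)) : ℝ) : EReal)) atTop}

end Measure

section StepEncoding

variable {S : Type*}

open Classical in
theorem stepEncoding_hasSum (M : MDP S) (x : S × ℕ) (hx : x.1 ∉ M.controlled) :
    HasSum (fun y : S × ℕ =>
      if M.trans x.1 y.1 ∧ y.2 = x.2 + 1 then M.prob ⟨x.1, hx⟩ y.1 else 0) 1 := by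
  have hinj : Function.Injective (fun s' : S => (s', x.2 + 1)) := fun a b h => (Prod.ext_iff.1 h).1
  rw [← hinj.hasSum_iff]
  · convert! (M.prob ⟨x.1, hx⟩).2 using 1
    funext s'
    by_cases h : M.trans x.1 s'
    · simp [h]; rfl
    · have : M.prob ⟨x.1, hx⟩ s' = 0 := by
        by_contra h0
        exact h (M.prob_support _ s' ((PMF.mem_support_iff _ _).2 h0))
      simp [h]
      exact this.symm
  · rintro ⟨s', m⟩ hy
    refine if_neg fun h => hy ⟨s', ?_⟩
    simpa using h.2.symm

open Classical in
/-- The MDP `S(M)`, which encodes the step counter into the states of `M`. -/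
noncomputable def stepEncoding (M : MDP S) : MDP (S × ℕ) where
  controlled := {x | x.1 ∈ M.controlled}
  trans x y := M.trans x.1 y.1 ∧ y.2 = x.2 + 1
  exists_succ x := (M.exists_succ x.1).elim fun s' h => ⟨(s', x.2 + 1), h, rfl⟩
  prob x := ⟨fun y =>
    if M.trans x.1.1 y.1 ∧ y.2 = x.1.2 + 1 then M.prob ⟨x.1.1, x.2⟩ y.1 else 0,
    M.stepEncoding_hasSum x.1 x.2⟩
  prob_support x y hy := by
    by_contra h
    exact (PMF.mem_support_iff _ _).1 hy (if_neg h)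
  reward x y := M.reward x.1 y.1

end StepEncoding

section RewardEncoding

variable {S : Type*}

/-- `M.Attainable s₀ s q`: some finite path from `s₀` to `s` has total reward `q`. -/
inductive Attainable (M : MDP S) (s₀ : S) : S → ℝ → Prop
  | init : Attainable M s₀ s₀ 0
  | step {s s' : S} {q : ℝ} (hq : Attainable M s₀ s q) (h : M.trans s s') :
      Attainable M s₀ s' (q + M.reward s s')

/-- The states of `R(M)`: pairs of a state and a reward level attainable there from `s₀`. -/
def RewardState (M : MDP S) (s₀ : S) : Type _ :=
  {p : S × ℝ // M.Attainable s₀ p.1 p.2}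

namespace RewardState

variable {M : MDP S} {s₀ : S}

/-- The underlying state of `M`. -/
def state (x : M.RewardState s₀) : S := x.1.1

/-- The encoded reward level. -/
def level (x : M.RewardState s₀) : ℝ := x.1.2

/-- The state reached from `x` by the transition to `s'`. -/
noncomputable def succ (x : M.RewardState s₀) (s' : S) (h : M.trans x.state s') :
    M.RewardState s₀ :=
  ⟨(s', x.level + M.reward x.state s'), .step x.2 h⟩

theorem ext' {x y : M.RewardState s₀} (h : x.state = y.state) (h' : x.level = y.level) : x = y :=
  Subtype.ext (Prod.ext h h')

instance [Countable S] : Countable (M.RewardState s₀) := by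
  let T : ℕ → Set (S × ℝ) := fun n => n.rec {(s₀, 0)} fun _ A =>
    (fun z : (S × ℝ) × S => (z.2, z.1.2 + M.reward z.1.1 z.2)) '' (A ×ˢ Set.univ)
  have hT : ∀ n, (T n).Countable := by
    intro n
    induction n with
    | zero => exact Set.countable_singleton _
    | succ n ih => exact (ih.prod Set.countable_univ).image _
  have hsub : {p : S × ℝ | M.Attainable s₀ p.1 p.2} ⊆ ⋃ n, T n := by
    rintro ⟨s, q⟩ h
    change M.Attainable s₀ s q at h
    induction h with
    | init => exact Set.mem_iUnion.2 ⟨0, rfl⟩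
    | @step s s' q _ _ ih =>
      obtain ⟨n, hn⟩ := Set.mem_iUnion.1 ih
      exact Set.mem_iUnion.2 ⟨n + 1, ((s, q), s'), ⟨hn, trivial⟩, rfl⟩
  exact ((Set.countable_iUnion hT).mono hsub).to_subtype

end RewardState

open Classical in
theorem rewardEncoding_hasSum (M : MDP S) (s₀ : S) (x : M.RewardState s₀)
    (hx : x.state ∉ M.controlled) :
    HasSum (fun y : M.RewardState s₀ =>
      if M.trans x.state y.state ∧ y.level = x.level + M.reward x.state y.state
      then M.prob ⟨x.state, hx⟩ y.state else 0) 1 := by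
  let g : {s' : S // M.trans x.state s'} → M.RewardState s₀ := fun s' => x.succ s'.1 s'.2
  have hinj : Function.Injective g := fun a b h =>
    Subtype.ext (congrArg RewardState.state h)
  rw [← hinj.hasSum_iff]
  · have h1 := (M.prob ⟨x.state, hx⟩).2
    rw [← hasSum_subtype_iff_of_support_subset (s := {s' | M.trans x.state s'})] at h1
    · convert! h1 using 1
      funext s'
      exact if_pos ⟨s'.2, rfl⟩
    · intro s' hs'
      exact M.prob_support _ s' ((PMF.mem_support_iff _ _).2 hs')
  · intro y hy
    refine if_neg fun h => hy ⟨⟨y.state, h.1⟩, ?_⟩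
    exact RewardState.ext' rfl h.2.symm

open Classical in
/-- The MDP `R(M)` (for the initial state `s₀`), which encodes the reward counter into the states of
`M`; the reward of a transition is the reward level of its target. -/
noncomputable def rewardEncoding (M : MDP S) (s₀ : S) : MDP (M.RewardState s₀) where
  controlled := {x | x.state ∈ M.controlled}
  trans x y := M.trans x.state y.state ∧ y.level = x.level + M.reward x.state y.state
  exists_succ x := (M.exists_succ x.state).elim fun s' h => ⟨x.succ s' h, h, rfl⟩
  prob x := ⟨fun y =>
    if M.trans x.1.state y.state ∧ y.level = x.1.level + M.reward x.1.state y.state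
    then M.prob ⟨x.1.state, x.2⟩ y.state else 0,
    M.rewardEncoding_hasSum s₀ x.1 x.2⟩
  prob_support x y hy := by
    by_contra h
    exact (PMF.mem_support_iff _ _).1 hy (if_neg h)
  reward _ y := y.level

/-- The total payoff objective in `S(R(M))`: the `liminf` of the total reward is nonnegative, where
the total reward is that of `M`, summed along the run and starting with the level that is encoded in
the first state of the run (this level is `0` in the initial state `((s₀, 0), 0)`). -/
def encodedTotalPayoff (M : MDP S) (s₀ : S) : Set (ℕ → M.RewardState s₀ × ℕ) :=
  {ρ | 0 ≤ liminf (fun n => (((ρ 0).1.level +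
    ∑ j ∈ Finset.range n, M.reward (ρ j).1.state (ρ (j + 1)).1.state : ℝ) : EReal)) atTop}

end RewardEncoding

end MDP

/-! The liminf objective is reduced to a safety objective. Fix a near-optimal strategy `σ`. By
continuity of measure there are times `m i` such that, up to a small probability, the runs in the
objective have payoff at least `-1/(i+1)` from time `m i` on, for all `i` at once
(`exists_law_liminfPayoff_le`). In the presence of a step counter this is a condition on single
steps.

For such a condition, value an observation `y` by the best probability with which `σ` stays safe
after some history observed as `y`. A step of `σ` averages these values over successors, so some
successor loses arbitrarily little; `f` picks one with loss at most `c * 2⁻¹ ^ (level y + 1)`. The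
level grows at every step, so the losses add up to at most `c`. This bounds the safety of `f` from
below on every finite horizon (`safetyValue_le_law_safeUntil`), hence forever
(`exists_law_safeFrom_le`).

The memory only has to be updated deterministically, to contain the state and a step counter, and to
determine the payoff of the next step. `Observation` isolates this, and both claims are instances:
the state of S(R(M)) itself, and the triple of state, step counter and reward counter. -/

namespace MDP

/-- The σ-algebra of all subsets. -/
@[reducible]
def discreteMeasurableSpace (S : Type*) : MeasurableSpace S := ⊤

-- The low priority leaves the cylinder σ-algebra on `ℕ → S` in place.
attribute [local instance 10] discreteMeasurableSpace

/-! ### One-step analysis of the law of a play -/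

section Law

variable {S : Type*} [Countable S] {M : MDP S}

open Preorder

/-- The history `h` prolonged by the state `s`. -/
def History.snoc {S : Type*} {n : ℕ} (h : History S n) (s : S) : History S (n + 1) :=
  fun i => if hi : i.1 ≤ n then h ⟨i.1, Finset.mem_Iic.2 hi⟩ else s

@[simp]
theorem History.last_snoc {S : Type*} {n : ℕ} (h : History S n) (s : S) : (h.snoc s).last = s := by
  simp [History.last, History.snoc]

theorem frestrictLe_succ_eq_snoc {S : Type*} (ρ : ℕ → S) (n : ℕ) :
    frestrictLe (π := fun _ => S) (n + 1) ρ =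
      History.snoc (frestrictLe (π := fun _ => S) n ρ) (ρ (n + 1)) := by
  funext i
  by_cases hi : i.1 ≤ n
  · simp [History.snoc, hi]
  · have : i.1 = n + 1 := by
      have := Finset.mem_Iic.1 i.2
      omega
    simp [History.snoc, this]

/-- The law of the play under `σ` after the history `h`. -/
noncomputable def Strategy.law (σ : M.Strategy) {n : ℕ} (h : History S n) : Measure (ℕ → S) :=
  Kernel.traj (X := fun _ => S) σ.kernel n h

theorem Strategy.probability_eq_law (σ : M.Strategy) (s : S) (E : Set (ℕ → S)) :
    σ.probability s E = σ.law (n := 0) (fun _ => s) E := rfl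

instance (σ : M.Strategy) {n : ℕ} (h : History S n) : IsProbabilityMeasure (σ.law h) := by
  unfold Strategy.law
  infer_instance

/-- The trajectory kernel at time `n` is the one at time `n + 1` composed with a single step, and
integration over that step is a countable sum. -/
theorem Strategy.law_eq_tsum (σ : M.Strategy) {n : ℕ} (h : History S n) {B : Set (ℕ → S)}
    (hB : MeasurableSet B) :
    σ.law h B = ∑' s, σ.next h s * σ.law (h.snoc s) B := by
  unfold Strategy.law
  conv_lhs => rw [← Kernel.traj_comp_partialTraj (X := fun _ => S) (κ := σ.kernel) n.le_succ]
  have hm : Measurable fun x : History S (n + 1) =>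
      Kernel.traj (X := fun _ => S) σ.kernel (n + 1) x B := Kernel.measurable_coe _ hB
  have hm2 : Measurable fun x : History S n × (∀ i : Finset.Ioc n (n + 1), S) =>
      Kernel.traj (X := fun _ => S) σ.kernel (n + 1)
        (IicProdIoc (X := fun _ => S) n (n + 1) x) B :=
    hm.comp (measurable_IicProdIoc (X := fun _ => S))
  have hm3 : Measurable fun x : (∀ i : Finset.Ioc n (n + 1), S) =>
      Kernel.traj (X := fun _ => S) σ.kernel (n + 1)
        (IicProdIoc (X := fun _ => S) n (n + 1) (h, x)) B :=
    hm2.comp measurable_prodMk_left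
  have := Kernel.IsMarkovKernel.map (σ.kernel n)
    (MeasurableEquiv.piSingleton (X := fun _ => S) n).measurable
  rw [Kernel.comp_apply' _ _ _ hB, Kernel.partialTraj_succ_self,
    Kernel.lintegral_map _ (measurable_IicProdIoc (X := fun _ => S)) _ hm,
    Kernel.lintegral_id_prod hm2,
    Kernel.lintegral_map _ (MeasurableEquiv.piSingleton (X := fun _ => S) n).measurable _ hm3,
    lintegral_countable']
  refine tsum_congr fun s => ?_
  rw [mul_comm]
  congr 1
  · exact PMF.toMeasure_apply_singleton _ _ (MeasurableSet.singleton _)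
  · congr 2
    funext i
    by_cases hi : i.1 ≤ n
    · simp [IicProdIoc, History.snoc, hi]
    · have hi' : i = ⟨n + 1, Finset.mem_Iic.2 le_rfl⟩ := by
        have := Finset.mem_Iic.1 i.2
        exact Subtype.ext (by dsimp only; omega)
      subst hi'
      simp [IicProdIoc, History.snoc, MeasurableEquiv.piSingleton]

theorem Strategy.ae_frestrictLe_eq (σ : M.Strategy) {n : ℕ} (h : History S n) :
    ∀ᵐ ρ ∂σ.law h, frestrictLe (π := fun _ => S) n ρ = h := by
  have h1 := Kernel.traj_map_frestrictLe_apply (X := fun _ => S) (κ := σ.kernel) n n h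
  rw [Kernel.partialTraj_self, Kernel.id_apply] at h1
  refine ae_of_ae_map (μ := σ.law h) (p := fun x => x = h)
    (measurable_frestrictLe (X := fun _ => S) n).aemeasurable ?_
  unfold Strategy.law
  rw [h1, ae_dirac_eq]
  exact rfl

theorem measurableSet_step (A : ∀ {n : ℕ}, History S n → S → Prop) (k : ℕ) :
    MeasurableSet {ρ : ℕ → S | A (frestrictLe (π := fun _ => S) k ρ) (ρ (k + 1))} := by
  have hm : Measurable fun ρ : ℕ → S =>
      ((frestrictLe (π := fun _ => S) k ρ, ρ (k + 1)) : History S k × S) :=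
    (measurable_frestrictLe (X := fun _ => S) k).prodMk (measurable_pi_apply _)
  exact hm (MeasurableSet.of_discrete (s := {p : History S k × S | A p.1 p.2}))

-- After `h.snoc s` the first `n + 1` steps are almost surely fixed, so the condition on the step at
-- time `n` is decided by `h` and `s`.
open Classical in
theorem Strategy.law_step_inter (σ : M.Strategy) {n : ℕ} (h : History S n)
    (A : ∀ {n : ℕ}, History S n → S → Prop) {B : Set (ℕ → S)} (hB : MeasurableSet B) :
    σ.law h ({ρ | A (frestrictLe (π := fun _ => S) n ρ) (ρ (n + 1))} ∩ B) =
      ∑' s, σ.next h s * if A h s then σ.law (h.snoc s) B else 0 := by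
  rw [σ.law_eq_tsum h ((measurableSet_step A n).inter hB)]
  refine tsum_congr fun s => ?_
  congr 1
  have key : ∀ᵐ ρ ∂σ.law (h.snoc s),
      (A (frestrictLe (π := fun _ => S) n ρ) (ρ (n + 1)) ↔ A h s) := by
    filter_upwards [σ.ae_frestrictLe_eq (h.snoc s)] with ρ hρ
    have h1 : frestrictLe (π := fun _ => S) n ρ = h := by
      funext i
      have h2 := congrFun hρ ⟨i.1, Finset.mem_Iic.2 ((Finset.mem_Iic.1 i.2).trans n.le_succ)⟩
      simpa [History.snoc, Finset.mem_Iic.1 i.2] using h2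
    have h2 : ρ (n + 1) = s := by
      have h3 := congrFun hρ ⟨n + 1, Finset.mem_Iic.2 le_rfl⟩
      simpa [History.snoc] using h3
    rw [h1, h2]
  split_ifs with hA
  · refine measure_congr ?_
    filter_upwards [key] with ρ hρ
    exact propext ⟨fun h => h.2, fun h => ⟨hρ.2 hA, h⟩⟩
  · refine measure_mono_null (fun ρ hρ => ?_) (ae_iff.1 key)
    exact fun h => hA (h.1 hρ.1)

theorem Strategy.trans_of_next_ne_zero {S : Type*} {M : MDP S} (σ : M.Strategy) {n : ℕ}
    (h : History S n) {s : S} (hs : σ.next h s ≠ 0) : M.trans h.last s := by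
  unfold Strategy.next at hs
  split_ifs at hs with hc
  · exact σ.choice_support h hc s ((PMF.mem_support_iff _ _).2 hs)
  · exact M.prob_support _ s ((PMF.mem_support_iff _ _).2 hs)

/-- The measure lives on all sequences of states; this confines attention to runs, the only place
where counters are known to behave. -/
theorem Strategy.ae_trans (σ : M.Strategy) (s : S) :
    ∀ᵐ ρ ∂σ.law (n := 0) (fun _ => s), ρ 0 = s ∧ ∀ k, M.trans (ρ k) (ρ (k + 1)) := by
  refine Eventually.and ?_ (ae_all_iff.2 fun k => ?_)
  · filter_upwards [σ.ae_frestrictLe_eq (n := 0) (fun _ => s)] with ρ hρ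
    exact congrFun hρ ⟨0, Finset.mem_Iic.2 le_rfl⟩
  · have hm := measurableSet_step (fun {n} (h : History S n) s => ¬ M.trans h.last s) k
    have h0 : ∀ h : History S k, σ.law h
        {ρ | ¬ M.trans (History.last (frestrictLe (π := fun _ => S) k ρ)) (ρ (k + 1))} = 0 := by
      intro h
      have h1 := σ.law_step_inter h (fun {n} (h : History S n) s => ¬ M.trans h.last s)
        MeasurableSet.univ
      rw [Set.inter_univ] at h1
      rw [h1, ENNReal.tsum_eq_zero]
      intro s
      by_cases hs : σ.next h s = 0
      · simp [hs]
      · simp [σ.trans_of_next_ne_zero h hs]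
    change σ.law (n := 0) (fun _ => s)
      {ρ | ¬ M.trans (History.last (frestrictLe (π := fun _ => S) k ρ)) (ρ (k + 1))} = 0
    unfold Strategy.law at h0 ⊢
    rw [← Kernel.traj_comp_partialTraj (X := fun _ => S) (κ := σ.kernel) k.zero_le,
      Kernel.comp_apply' _ _ _ hm]
    simp [h0]

end Law

/-! ### Observations and safety events -/

section Observation

open Preorder

/-- A deterministic update of information about the history, which includes the current state and a
counter that is increased by every transition. -/
structure Observation {S : Type*} (M : MDP S) (Y : Type*) where
  obs : ∀ {n : ℕ}, History S n → Y
  state : Y → S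
  state_obs : ∀ {n : ℕ} (h : History S n), state (obs h) = h.last
  update : Y → S → Y
  obs_snoc : ∀ {n : ℕ} (h : History S n) (s : S), obs (h.snoc s) = update (obs h) s
  level : Y → ℕ
  -- Restricted to transitions: in S(M) the counter is read off the next state, which is arbitrary
  -- otherwise.
  level_update : ∀ y s, M.trans (state y) s → level (update y s) = level y + 1

variable {S : Type*} {M : MDP S} {Y : Type*} (O : M.Observation Y)

namespace Observation

/-- The observation of the first `k` steps of a sequence of states. -/
def along (ρ : ℕ → S) (k : ℕ) : Y := O.obs (frestrictLe (π := fun _ => S) k ρ)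

theorem along_succ (ρ : ℕ → S) (k : ℕ) : O.along ρ (k + 1) = O.update (O.along ρ k) (ρ (k + 1)) := by
  unfold along
  rw [frestrictLe_succ_eq_snoc, O.obs_snoc]

theorem state_along (ρ : ℕ → S) (k : ℕ) : O.state (O.along ρ k) = ρ k := by
  unfold along
  rw [O.state_obs]
  rfl

theorem level_along {ρ : ℕ → S} (hρ : ∀ k, M.trans (ρ k) (ρ (k + 1))) (k : ℕ) :
    O.level (O.along ρ k) = O.level (O.along ρ 0) + k := by
  induction k with
  | zero => rfl
  | succ k ih =>
    rw [along_succ, O.level_update _ _ (by rw [state_along]; exact hρ k), ih, add_assoc]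

/-- All steps from time `n` on satisfy `A`. -/
def safeFrom (A : Y → S → Prop) (n : ℕ) : Set (ℕ → S) :=
  {ρ | ∀ k, n ≤ k → A (O.along ρ k) (ρ (k + 1))}

/-- All steps from time `n` until time `n + N` satisfy `A`. -/
def safeUntil (A : Y → S → Prop) (n N : ℕ) : Set (ℕ → S) :=
  {ρ | ∀ k, n ≤ k → k < n + N → A (O.along ρ k) (ρ (k + 1))}

theorem safeFrom_eq_inter (A : Y → S → Prop) (n : ℕ) :
    O.safeFrom A n = {ρ | A (O.along ρ n) (ρ (n + 1))} ∩ O.safeFrom A (n + 1) := by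
  ext ρ
  refine ⟨fun h => ⟨h n le_rfl, fun k hk => h k (by omega)⟩, fun h k hk => ?_⟩
  rcases hk.eq_or_lt with rfl | hk
  exacts [h.1, h.2 k hk]

theorem safeUntil_succ_eq_inter (A : Y → S → Prop) (n N : ℕ) :
    O.safeUntil A n (N + 1) = {ρ | A (O.along ρ n) (ρ (n + 1))} ∩ O.safeUntil A (n + 1) N := by
  ext ρ
  refine ⟨fun h => ⟨h n le_rfl (by omega), fun k hk hk' => h k (by omega) (by omega)⟩,
    fun h k hk hk' => ?_⟩
  rcases hk.eq_or_lt with rfl | hk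
  exacts [h.1, h.2 k hk (by omega)]

theorem safeFrom_eq_iInter (A : Y → S → Prop) (n : ℕ) :
    O.safeFrom A n = ⋂ N, O.safeUntil A n N := by
  ext ρ
  simp only [Set.mem_iInter]
  exact ⟨fun h N k hk _ => h k hk, fun h k hk => h (k + 1) k hk (by omega)⟩

variable [Countable S]

theorem measurableSet_along (A : Y → S → Prop) (k : ℕ) :
    MeasurableSet {ρ : ℕ → S | A (O.along ρ k) (ρ (k + 1))} :=
  measurableSet_step (fun {_} h s => A (O.obs h) s) k

theorem measurableSet_safeFrom (A : Y → S → Prop) (n : ℕ) : MeasurableSet (O.safeFrom A n) := by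
  have : O.safeFrom A n = ⋂ k, ⋂ (_ : n ≤ k), {ρ : ℕ → S | A (O.along ρ k) (ρ (k + 1))} := by
    ext ρ
    simp [safeFrom]
  rw [this]
  exact .iInter fun k => .iInter fun _ => O.measurableSet_along A k

theorem measurableSet_safeUntil (A : Y → S → Prop) (n N : ℕ) :
    MeasurableSet (O.safeUntil A n N) := by
  have : O.safeUntil A n N = ⋂ k, ⋂ (_ : n ≤ k), ⋂ (_ : k < n + N),
      {ρ : ℕ → S | A (O.along ρ k) (ρ (k + 1))} := by
    ext ρ
    simp [safeUntil]
  rw [this]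
  exact .iInter fun k => .iInter fun _ => .iInter fun _ => O.measurableSet_along A k

open Classical in
theorem law_safeFrom (A : Y → S → Prop) (σ : M.Strategy) {n : ℕ} (h : History S n) :
    σ.law h (O.safeFrom A n) = ∑' s, σ.next h s *
      if A (O.obs h) s then σ.law (h.snoc s) (O.safeFrom A (n + 1)) else 0 := by
  rw [safeFrom_eq_inter]
  exact σ.law_step_inter h (fun {_} h s => A (O.obs h) s) (O.measurableSet_safeFrom A _)

open Classical in
theorem law_safeUntil_succ (A : Y → S → Prop) (σ : M.Strategy) {n : ℕ} (h : History S n) (N : ℕ) :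
    σ.law h (O.safeUntil A n (N + 1)) = ∑' s, σ.next h s *
      if A (O.obs h) s then σ.law (h.snoc s) (O.safeUntil A (n + 1) N) else 0 := by
  rw [safeUntil_succ_eq_inter]
  exact σ.law_step_inter h (fun {_} h s => A (O.obs h) s) (O.measurableSet_safeUntil A _ _)

/-! ### Safety values and near-optimal choices -/

/-- The best probability of satisfying `A` forever under `σ`, after a history that is observed
as `y`. -/
noncomputable def safetyValue (A : Y → S → Prop) (σ : M.Strategy) (y : Y) : ENNReal :=
  -- An observation need not determine the length of the history: a counter encoded in the state may
  -- start anywhere.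
  ⨆ (n : ℕ) (h : History S n) (_ : O.obs h = y), σ.law h (O.safeFrom A n)

theorem le_safetyValue (A : Y → S → Prop) (σ : M.Strategy) {n : ℕ} (h : History S n) :
    σ.law h (O.safeFrom A n) ≤ O.safetyValue A σ (O.obs h) :=
  le_iSup_of_le n (le_iSup_of_le h (le_iSup_of_le rfl le_rfl))

theorem safetyValue_le_one (A : Y → S → Prop) (σ : M.Strategy) (y : Y) :
    O.safetyValue A σ y ≤ 1 :=
  iSup_le fun _ => iSup_le fun _ => iSup_le fun _ => prob_le_one

open Classical in
/-- The safety value after the step from `y` to `s`, which is `0` if the step violates `A`. -/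
noncomputable def stepValue (A : Y → S → Prop) (σ : M.Strategy) (y : Y) (s : S) : ENNReal :=
  if A y s then O.safetyValue A σ (O.update y s) else 0

theorem law_safeFrom_le (A : Y → S → Prop) (σ : M.Strategy) {n : ℕ} (h : History S n) :
    σ.law h (O.safeFrom A n) ≤ ∑' s, σ.next h s * O.stepValue A σ (O.obs h) s := by
  rw [law_safeFrom]
  unfold stepValue
  gcongr with s
  split_ifs
  · rw [← O.obs_snoc]
    exact O.le_safetyValue A σ _
  · rfl

theorem safetyValue_le_of_random (A : Y → S → Prop) (σ : M.Strategy) {y : Y}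
    (hy : O.state y ∉ M.controlled) :
    O.safetyValue A σ y ≤ ∑' s, M.prob ⟨O.state y, hy⟩ s * O.stepValue A σ y s := by
  refine iSup_le fun n => iSup_le fun h => iSup_le fun hh => ?_
  subst hh
  refine (O.law_safeFrom_le A σ h).trans_eq ?_
  have hr : h.last ∉ M.controlled := by rwa [← O.state_obs h]
  have : σ.next h = M.prob ⟨O.state (O.obs h), hy⟩ := by
    unfold Strategy.next
    rw [dif_neg hr]
    congr 2
    exact (O.state_obs h).symm
  rw [this]

theorem safetyValue_le_iSup (A : Y → S → Prop) (σ : M.Strategy) (y : Y) :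
    O.safetyValue A σ y ≤ ⨆ s : {s // M.trans (O.state y) s}, O.stepValue A σ y s := by
  refine iSup_le fun n => iSup_le fun h => iSup_le fun hh => ?_
  subst hh
  refine (O.law_safeFrom_le A σ h).trans ?_
  set V := ⨆ s : {s // M.trans (O.state (O.obs h)) s}, O.stepValue A σ (O.obs h) s
  calc ∑' s, σ.next h s * O.stepValue A σ (O.obs h) s
      ≤ ∑' s, σ.next h s * V := by
        refine ENNReal.tsum_le_tsum fun s => ?_
        by_cases hs : σ.next h s = 0
        · simp [hs]
        · have ht : M.trans (O.state (O.obs h)) s := by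
            rw [O.state_obs]
            exact σ.trans_of_next_ne_zero h hs
          gcongr
          exact le_iSup (fun s : {s // M.trans (O.state (O.obs h)) s} =>
            O.stepValue A σ (O.obs h) s) ⟨s, ht⟩
    _ = V := by rw [ENNReal.tsum_mul_right, PMF.tsum_coe, one_mul]

/-- With infinite branching the supremum over successors need not be attained, hence the slack `c`.
-/
theorem exists_succ_safetyValue_le (A : Y → S → Prop) (σ : M.Strategy) (y : Y) {c : ENNReal}
    (hc : c ≠ 0) :
    ∃ s, M.trans (O.state y) s ∧ O.safetyValue A σ y ≤ O.stepValue A σ y s + c := by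
  obtain ⟨s₀, hs₀⟩ := M.exists_succ (O.state y)
  by_cases h : O.safetyValue A σ y ≤ c
  · exact ⟨s₀, hs₀, h.trans le_add_self⟩
  · have hlt : O.safetyValue A σ y - c <
        ⨆ s : {s // M.trans (O.state y) s}, O.stepValue A σ y s :=
      (ENNReal.sub_lt_self (ne_top_of_le_ne_top ENNReal.one_ne_top (O.safetyValue_le_one A σ y))
        (fun h0 => h (h0 ▸ bot_le)) hc).trans_le (O.safetyValue_le_iSup A σ y)
    obtain ⟨s, hs⟩ := lt_iSup_iff.1 hlt
    exact ⟨s, s.2, tsub_le_iff_right.1 hs.le⟩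

/-- The deterministic strategy that plays `f` of the observation. -/
noncomputable def strategyOf (f : Y → S) (hf : ∀ y, M.trans (O.state y) (f y)) : M.Strategy where
  choice h _ := PMF.pure (f (O.obs h))
  choice_support h _ s hs := by
    rw [PMF.support_pure, Set.mem_singleton_iff] at hs
    rw [hs, ← O.state_obs]
    exact hf _

/-- Only controlled states cost `c`; in random states both strategies move with the same
distribution. -/
theorem safetyValue_le_next (A : Y → S → Prop) (σ : M.Strategy) (f : Y → S)
    (hf : ∀ y, M.trans (O.state y) (f y)) {c : Y → ENNReal}
    (hc : ∀ y, O.safetyValue A σ y ≤ O.stepValue A σ y (f y) + c y) {n : ℕ} (h : History S n) :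
    O.safetyValue A σ (O.obs h) ≤
      (∑' s, (O.strategyOf f hf).next h s * O.stepValue A σ (O.obs h) s) + c (O.obs h) := by
  by_cases hcon : h.last ∈ M.controlled
  · have : (O.strategyOf f hf).next h = PMF.pure (f (O.obs h)) := by
      unfold Strategy.next
      rw [dif_pos hcon]
      rfl
    rw [this, tsum_eq_single (f (O.obs h)) (by intro s hs; simp [PMF.pure_apply, hs])]
    simpa using hc (O.obs h)
  · have hcon' : O.state (O.obs h) ∉ M.controlled := by rwa [O.state_obs h]
    have : (O.strategyOf f hf).next h = M.prob ⟨O.state (O.obs h), hcon'⟩ := by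
      unfold Strategy.next
      rw [dif_neg hcon]
      congr 2
      exact (O.state_obs h).symm
    rw [this]
    exact (O.safetyValue_le_of_random A σ hcon').trans le_self_add

/-- Induction on the horizon. Half of the error budget at the current level pays for the present
choice; the other half is the whole budget at the next level. -/
theorem safetyValue_le_law_safeUntil (A : Y → S → Prop) (σ : M.Strategy) (f : Y → S)
    (hf : ∀ y, M.trans (O.state y) (f y)) {c : ENNReal}
    (hc : ∀ y, O.safetyValue A σ y ≤ O.stepValue A σ y (f y) + c * 2⁻¹ ^ (O.level y + 1)) (N : ℕ)
    {n : ℕ} (h : History S n) :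
    O.safetyValue A σ (O.obs h) ≤
      (O.strategyOf f hf).law h (O.safeUntil A n N) + c * 2⁻¹ ^ O.level (O.obs h) := by
  classical
  induction N generalizing n with
  | zero =>
    have : O.safeUntil A n 0 = Set.univ := by
      refine Set.eq_univ_of_forall fun ρ k hk hk' => ?_
      omega
    rw [this, measure_univ]
    exact (O.safetyValue_le_one A σ _).trans le_self_add
  | succ N ih =>
    set τ := O.strategyOf f hf
    set d : ENNReal := c * 2⁻¹ ^ (O.level (O.obs h) + 1) with hd
    have hdd : c * 2⁻¹ ^ O.level (O.obs h) = d + d := by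
      rw [hd, pow_succ, ← mul_assoc, ← mul_add, ENNReal.inv_two_add_inv_two, mul_one]
    calc O.safetyValue A σ (O.obs h)
        ≤ (∑' s, τ.next h s * O.stepValue A σ (O.obs h) s) + d :=
          O.safetyValue_le_next A σ f hf hc h
      _ ≤ (∑' s, τ.next h s * ((if A (O.obs h) s then
            τ.law (h.snoc s) (O.safeUntil A (n + 1) N) else 0) + d)) + d := by
          gcongr ?_ + d
          refine ENNReal.tsum_le_tsum fun s => ?_
          -- A state of probability zero may fail to be a successor, and then the level need not
          -- increase.
          by_cases hs : τ.next h s = 0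
          · simp [hs]
          gcongr
          unfold stepValue
          split_ifs
          · have h1 := ih (h.snoc s)
            rwa [O.obs_snoc, O.level_update _ _ (by
              rw [O.state_obs]; exact τ.trans_of_next_ne_zero h hs)] at h1
          · exact bot_le
      _ = τ.law h (O.safeUntil A n (N + 1)) + (d + d) := by
          simp_rw [mul_add]
          rw [ENNReal.tsum_add, ENNReal.tsum_mul_right, PMF.tsum_coe, one_mul,
            ← O.law_safeUntil_succ, add_assoc]
      _ = _ := by rw [hdd]

theorem exists_law_safeFrom_le (A : Y → S → Prop) (σ : M.Strategy) {c : ENNReal} (hc : c ≠ 0)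
    (h : History S 0) :
    ∃ (f : Y → S) (hf : ∀ y, M.trans (O.state y) (f y)),
      σ.law h (O.safeFrom A 0) ≤ (O.strategyOf f hf).law h (O.safeFrom A 0) + c := by
  have hne : ∀ y, c * 2⁻¹ ^ (O.level y + 1) ≠ 0 := fun y =>
    mul_ne_zero hc (pow_ne_zero _ (by simp))
  choose f hf hfc using fun y => O.exists_succ_safetyValue_le A σ y (hne y)
  refine ⟨f, hf, (O.le_safetyValue A σ h).trans ?_⟩
  set τ := O.strategyOf f hf
  have hanti : Antitone (O.safeUntil A 0) := fun N N' hN ρ hρ k hk hk' =>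
    hρ k hk (by omega)
  have ht := tendsto_measure_iInter_atTop (μ := τ.law h)
    (fun N => (O.measurableSet_safeUntil A 0 N).nullMeasurableSet) hanti
    ⟨0, measure_ne_top _ _⟩
  rw [← safeFrom_eq_iInter] at ht
  -- The bound is uniform in the horizon, so it survives continuity from above.
  refine ge_of_tendsto' (ht.add_const c) fun N => ?_
  refine (O.safetyValue_le_law_safeUntil A σ f hf hfc N h).trans ?_
  refine add_le_add le_rfl ?_
  exact mul_le_of_le_one_right' (pow_le_one' (ENNReal.inv_le_one.2 one_le_two) _)

end Observation

end Observation

/-! ### From liminf objectives to safety -/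

theorem liminf_coe_nonneg_iff (u : ℕ → ℝ) :
    0 ≤ liminf (fun n => (u n : EReal)) atTop ↔
      ∀ i : ℕ, ∃ n, ∀ k, n ≤ k → -(1 / ((i : ℝ) + 1)) ≤ u k := by
  constructor
  · intro h i
    have hlt : ((-(1 / ((i : ℝ) + 1)) : ℝ) : EReal) < liminf (fun n => (u n : EReal)) atTop := by
      refine lt_of_lt_of_le ?_ h
      rw [← EReal.coe_zero, EReal.coe_lt_coe_iff]
      exact neg_neg_of_pos Nat.one_div_pos_of_nat
    obtain ⟨n, hn⟩ := eventually_atTop.1 (eventually_lt_of_lt_liminf hlt)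
    exact ⟨n, fun k hk => (EReal.coe_lt_coe_iff.1 (hn k hk)).le⟩
  · intro h
    refine le_of_forall_lt fun a ha => ?_
    obtain ⟨b, hab, hb⟩ := EReal.lt_iff_exists_real_btwn.1 ha
    have hb' : 0 < -b := neg_pos.2 (by rwa [← EReal.coe_zero, EReal.coe_lt_coe_iff] at hb)
    obtain ⟨i, hi⟩ := exists_nat_one_div_lt hb'
    obtain ⟨n, hn⟩ := h i
    refine hab.trans_le (le_liminf_of_le (by isBoundedDefault) ?_)
    filter_upwards [eventually_ge_atTop n] with k hk
    rw [EReal.coe_le_coe_iff]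
    linarith [hn k hk]

section Liminf

variable {S : Type*} [Countable S] {M : MDP S} {Y : Type*} (O : M.Observation Y)

namespace Observation

/-- The `liminf` of the payoffs `p`, which depend on the observation and the next state, is
nonnegative. -/
def liminfPayoff {S : Type*} {M : MDP S} {Y : Type*} (O : M.Observation Y) (p : Y → S → ℝ) :
    Set (ℕ → S) :=
  {ρ | 0 ≤ liminf (fun k => ((p (O.along ρ k) (ρ (k + 1)) : ℝ) : EReal)) atTop}

theorem mem_liminfPayoff {S : Type*} {M : MDP S} {Y : Type*} (O : M.Observation Y)
    (p : Y → S → ℝ) (ρ : ℕ → S) :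
    ρ ∈ O.liminfPayoff p ↔ ∀ i : ℕ, ∃ n,
      ρ ∈ O.safeFrom (fun y s => -(1 / ((i : ℝ) + 1)) ≤ p y s) n :=
  liminf_coe_nonneg_iff _

theorem measurableSet_liminfPayoff (p : Y → S → ℝ) : MeasurableSet (O.liminfPayoff p) := by
  have : O.liminfPayoff p =
      ⋂ i : ℕ, ⋃ n, O.safeFrom (fun y s => -(1 / ((i : ℝ) + 1)) ≤ p y s) n := by
    ext ρ
    simp only [Set.mem_iInter, Set.mem_iUnion]
    exact O.mem_liminfPayoff p ρ
  rw [this]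
  exact .iInter fun i => .iUnion fun n => O.measurableSet_safeFrom _ n

/-- Up to an arbitrarily small probability, the convergence in `liminfPayoff` is uniform. -/
theorem exists_law_liminfPayoff_le (p : Y → S → ℝ) (σ : M.Strategy) (h : History S 0)
    {δ : ENNReal} (hδ : δ ≠ 0) :
    ∃ m : ℕ → ℕ, σ.law h (O.liminfPayoff p) ≤
      σ.law h (⋂ i : ℕ, O.safeFrom (fun y s => -(1 / ((i : ℝ) + 1)) ≤ p y s) (m i)) + δ := by
  obtain ⟨δ', hδ', hsum⟩ := ENNReal.exists_pos_sum_of_countable hδ ℕ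
  set F : ℕ → ℕ → Set (ℕ → S) := fun i n =>
    O.safeFrom (fun y s => -(1 / ((i : ℝ) + 1)) ≤ p y s) n with hF
  -- For fixed `i`, the runs in the objective that still violate the threshold after time `n`
  -- decrease to the empty set.
  have hex : ∀ i, ∃ n, σ.law h (O.liminfPayoff p \ F i n) ≤ δ' i := by
    intro i
    have hanti : Antitone fun n => O.liminfPayoff p \ F i n := fun n n' hn =>
      Set.sdiff_subset_sdiff_right fun ρ hρ k hk => hρ k (hn.trans hk)
    have ht := tendsto_measure_iInter_atTop (μ := σ.law h)
      (fun n => ((O.measurableSet_liminfPayoff p).diff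
        (O.measurableSet_safeFrom _ n)).nullMeasurableSet) hanti ⟨0, measure_ne_top _ _⟩
    have hempty : ⋂ n, O.liminfPayoff p \ F i n = ∅ := by
      refine Set.eq_empty_of_forall_notMem fun ρ hρ => ?_
      rw [Set.mem_iInter] at hρ
      obtain ⟨n, hn⟩ := (O.mem_liminfPayoff p ρ).1 (hρ 0).1 i
      exact (hρ n).2 hn
    rw [hempty, measure_empty] at ht
    obtain ⟨n, hn⟩ := (ht.eventually (gt_mem_nhds (ENNReal.coe_pos.2 (hδ' i)))).exists
    exact ⟨n, hn.le⟩
  choose m hm using hex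
  refine ⟨m, ?_⟩
  calc σ.law h (O.liminfPayoff p)
      ≤ σ.law h ((⋂ i, F i (m i)) ∪ ⋃ i, O.liminfPayoff p \ F i (m i)) := by
        refine measure_mono fun ρ hρ => ?_
        by_cases hi : ∀ i, ρ ∈ F i (m i)
        · exact Or.inl (Set.mem_iInter.2 hi)
        · obtain ⟨i, hi⟩ := not_forall.1 hi
          exact Or.inr (Set.mem_iUnion.2 ⟨i, hρ, hi⟩)
    _ ≤ σ.law h (⋂ i, F i (m i)) + ∑' i, σ.law h (O.liminfPayoff p \ F i (m i)) :=
        (measure_union_le _ _).trans (by gcongr; exact measure_iUnion_le _)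
    _ ≤ σ.law h (⋂ i, F i (m i)) + δ := by
        gcongr
        exact (ENNReal.tsum_le_tsum hm).trans hsum.le

theorem exists_law_liminfPayoff_le_strategyOf (p : Y → S → ℝ) (σ : M.Strategy) (s : S)
    {δ : ENNReal} (hδ : δ ≠ 0) :
    ∃ (f : Y → S) (hf : ∀ y, M.trans (O.state y) (f y)),
      σ.probability s (O.liminfPayoff p) ≤
        (O.strategyOf f hf).probability s (O.liminfPayoff p) + (δ + δ) := by
  simp only [Strategy.probability_eq_law]
  set h : History S 0 := fun _ => s
  obtain ⟨m, hm⟩ := O.exists_law_liminfPayoff_le p σ h hδ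
  -- Time `k` corresponds to level `O.level (O.obs h) + k`; the shift matters when the encoded
  -- counter does not start at zero.
  set A : Y → S → Prop := fun y s => ∀ i : ℕ, O.level (O.obs h) + m i ≤ O.level y →
    -(1 / ((i : ℝ) + 1)) ≤ p y s with hA
  obtain ⟨f, hf, hle⟩ := O.exists_law_safeFrom_le A σ hδ h
  refine ⟨f, hf, ?_⟩
  have key : ∀ τ : M.Strategy, ∀ᵐ ρ ∂τ.law h, ρ ∈ O.safeFrom A 0 ↔
      ρ ∈ ⋂ i : ℕ, O.safeFrom (fun y s => -(1 / ((i : ℝ) + 1)) ≤ p y s) (m i) := by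
    intro τ
    filter_upwards [τ.ae_trans s, τ.ae_frestrictLe_eq h] with ρ hρ hρh
    have hlev : ∀ k, O.level (O.along ρ k) = O.level (O.obs h) + k := by
      intro k
      rw [O.level_along hρ.2]
      congr 2
      unfold along
      rw [hρh]
    rw [Set.mem_iInter]
    constructor
    · intro hs i k hk
      exact hs k k.zero_le i (by rw [hlev]; omega)
    · intro hs k _ i hi
      exact hs i k (by rw [hlev] at hi; omega)
  calc σ.law h (O.liminfPayoff p)
      ≤ σ.law h (O.safeFrom A 0) + δ := hm.trans_eq <| by
        congr 1
        refine measure_congr ?_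
        filter_upwards [key σ] with ρ hρ
        exact propext hρ.symm
    _ ≤ (O.strategyOf f hf).law h (O.safeFrom A 0) + δ + δ := by gcongr
    _ ≤ (O.strategyOf f hf).law h (O.liminfPayoff p) + (δ + δ) := by
        rw [add_assoc]
        gcongr ?_ + _
        refine measure_mono_ae ?_
        filter_upwards [key (O.strategyOf f hf)] with ρ hρ hs
        exact (O.mem_liminfPayoff p ρ).2 fun i => ⟨m i, Set.mem_iInter.1 (hρ.1 hs) i⟩

theorem exists_isEpsOptimal_strategyOf (p : Y → S → ℝ) (s : S) {ε : ℝ} (hε : 0 < ε) :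
    ∃ (f : Y → S) (hf : ∀ y, M.trans (O.state y) (f y)),
      (O.strategyOf f hf).IsEpsOptimal ε s (O.liminfPayoff p) := by
  set δ := ENNReal.ofReal (ε / 3) with hδ
  have hδ0 : δ ≠ 0 := (ENNReal.ofReal_pos.2 (by positivity)).ne'
  have hδε : ENNReal.ofReal ε = δ + δ + δ := by
    rw [hδ, ← ENNReal.ofReal_add (by positivity) (by positivity),
      ← ENNReal.ofReal_add (by positivity) (by positivity)]
    congr 1
    ring
  by_cases hv : M.value s (O.liminfPayoff p) ≤ δ
  · choose f hf using fun y => M.exists_succ (O.state y)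
    refine ⟨f, hf, ?_⟩
    unfold Strategy.IsEpsOptimal
    -- If the value is this small, every strategy is `ε`-optimal; otherwise subtracting `δ` from the
    -- value is strict.
    rw [tsub_eq_zero_of_le (hv.trans (hδε ▸ le_add_self))]
    exact zero_le
  · have hfin : M.value s (O.liminfPayoff p) ≠ ⊤ :=
      ne_top_of_le_ne_top ENNReal.one_ne_top (iSup_le fun σ => prob_le_one (μ := σ.law _))
    have hlt := ENNReal.sub_lt_self hfin (fun h0 => hv (h0 ▸ zero_le)) hδ0
    obtain ⟨σ, hσ⟩ := lt_iSup_iff.1 hlt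
    obtain ⟨f, hf, hle⟩ := O.exists_law_liminfPayoff_le_strategyOf p σ s hδ0
    refine ⟨f, hf, tsub_le_iff_right.2 ?_⟩
    -- One `δ` pays for the choice of `σ`, one for uniform convergence, one for replacing `σ` by
    -- `f`.
    rw [hδε, ← add_assoc]
    exact (tsub_le_iff_right.1 hσ.le).trans (by gcongr)

theorem strategyOf_isDeterministic {S : Type*} {M : MDP S} {Y : Type*} (O : M.Observation Y)
    (f : Y → S) (hf : ∀ y, M.trans (O.state y) (f y)) : (O.strategyOf f hf).IsDeterministic :=
  fun _ h _ => ⟨f (O.obs h), rfl⟩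

end Observation

end Liminf

/-! ### The two instances -/

section Encoding

variable {S : Type*}

/-- The observation of the current state of `S(M)`. -/
def stepEncodingObservation (M : MDP S) : M.stepEncoding.Observation (S × ℕ) where
  obs h := h.last
  state := id
  state_obs _ := rfl
  update _ s := s
  obs_snoc h s := h.last_snoc s
  level := Prod.snd
  level_update _ _ h := h.2

theorem History.totalReward_snoc (M : MDP S) {n : ℕ} (h : History S n) (s : S) :
    (h.snoc s).totalReward M = h.totalReward M + M.reward h.last s := by
  unfold History.totalReward
  rw [Fin.sum_univ_castSucc]
  congr 1
  · refine Finset.sum_congr rfl fun i _ => ?_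
    simp [History.snoc, i.isLt.le, Nat.succ_le_of_lt i.isLt]
  · simp [History.snoc, History.last]

/-- The observation of the current state, the step counter and the reward counter. -/
noncomputable def counterObservation (M : MDP S) : M.Observation (S × ℕ × ℝ) where
  obs {n} h := (h.last, n, h.totalReward M)
  state := Prod.fst
  state_obs _ := rfl
  update y s := (s, y.2.1 + 1, y.2.2 + M.reward y.1 s)
  obs_snoc h s := by rw [h.last_snoc, h.totalReward_snoc]
  level y := y.2.1
  level_update _ _ _ := rfl

theorem totalPayoff_eq_liminfPayoff (M : MDP S) :
    M.totalPayoff = M.counterObservation.liminfPayoff fun y s => y.2.2 + M.reward y.1 s := by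
  ext ρ
  unfold totalPayoff Observation.liminfPayoff
  -- The payoff of step `k` is the total after `k + 1` transitions, so the empty sum is dropped.
  rw [Set.mem_ofPred_eq, Set.mem_ofPred_eq, ← liminf_nat_add _ 1]
  have : ∀ k, ∑ j ∈ Finset.range (k + 1), M.reward (ρ j) (ρ (j + 1)) =
      (M.counterObservation.along ρ k).2.2 +
        M.reward (M.counterObservation.along ρ k).1 (ρ (k + 1)) := by
    intro k
    rw [Finset.sum_range_succ, Finset.sum_range]
    rfl
  simp_rw [this]

theorem pointPayoff_eq_liminfPayoff (M : MDP S) :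
    M.stepEncoding.pointPayoff =
      M.stepEncodingObservation.liminfPayoff M.stepEncoding.reward := rfl

/-- Along a run the rewards telescope to the encoded level, and the point reward is the level of the
target; the two sequences differ by a shift by one. -/
theorem mem_encodedTotalPayoff_iff {M : MDP S} {s₀ : S} {ρ : ℕ → M.RewardState s₀ × ℕ}
    (hρ : ∀ k, (M.rewardEncoding s₀).stepEncoding.trans (ρ k) (ρ (k + 1))) :
    ρ ∈ M.encodedTotalPayoff s₀ ↔ ρ ∈ (M.rewardEncoding s₀).stepEncoding.pointPayoff := by
  have hlev : ∀ n, (ρ 0).1.level +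
      ∑ j ∈ Finset.range n, M.reward (ρ j).1.state (ρ (j + 1)).1.state = (ρ n).1.level := by
    intro n
    induction n with
    | zero => simp
    | succ n ih => rw [Finset.sum_range_succ, ← add_assoc, ih, (hρ n).1.2]
  unfold encodedTotalPayoff pointPayoff
  rw [Set.mem_ofPred_eq, Set.mem_ofPred_eq, ← liminf_nat_add _ 1]
  simp_rw [hlev]
  rfl

/-- Since this holds for every strategy, the values of both objectives agree too, and `ε`-optimality
transfers. -/
theorem probability_encodedTotalPayoff [Countable S] {M : MDP S} {s₀ : S}
    (σ : (M.rewardEncoding s₀).stepEncoding.Strategy) (x : M.RewardState s₀ × ℕ) :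
    σ.probability x (M.encodedTotalPayoff s₀) =
      σ.probability x (M.rewardEncoding s₀).stepEncoding.pointPayoff := by
  simp only [Strategy.probability_eq_law]
  refine measure_congr ?_
  filter_upwards [σ.ae_trans x] with ρ hρ
  exact propext (mem_encodedTotalPayoff_iff hρ.2)

end Encoding

end MDP

/-! ### The main theorem -/

theorem mainTheorem9 {S : Type*} [Countable S] (M : MDP S) (s₀ : S) (ε : ℝ) (hε : 0 < ε) :
    (∀ x : M.RewardState s₀ × ℕ,
      ∃ σ : (M.rewardEncoding s₀).stepEncoding.Strategy,
        σ.IsMD ∧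
        σ.IsEpsOptimal ε x (M.encodedTotalPayoff s₀) ∧
        σ.IsEpsOptimal ε x (M.rewardEncoding s₀).stepEncoding.pointPayoff) ∧
    (∃ σ : M.Strategy,
      σ.UsesStepAndRewardCounter ∧
      σ.IsDeterministic ∧
      σ.IsEpsOptimal ε s₀ M.totalPayoff) := by
  refine ⟨fun x => ?_, ?_⟩
  · set O := (M.rewardEncoding s₀).stepEncodingObservation
    obtain ⟨f, hf, hopt⟩ := O.exists_isEpsOptimal_strategyOf
      (M.rewardEncoding s₀).stepEncoding.reward x hε
    rw [← MDP.pointPayoff_eq_liminfPayoff] at hopt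
    refine ⟨O.strategyOf f hf, ⟨⟨fun y => PMF.pure (f y.1), fun _ _ _ => rfl⟩,
      O.strategyOf_isDeterministic f hf⟩, ?_, hopt⟩
    unfold MDP.Strategy.IsEpsOptimal MDP.value at hopt ⊢
    simpa only [MDP.probability_encodedTotalPayoff] using hopt
  · set O := M.counterObservation
    obtain ⟨f, hf, hopt⟩ := O.exists_isEpsOptimal_strategyOf
      (fun y s => y.2.2 + M.reward y.1 s) s₀ hε
    rw [← MDP.totalPayoff_eq_liminfPayoff] at hopt
    exact ⟨O.strategyOf f hf, ⟨fun s n q => PMF.pure (f (s.1, n, q)), fun _ _ _ => rfl⟩,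
      O.strategyOf_isDeterministic f hf, hopt⟩
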